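/- All Banach spaces are real. Let $X$ be a Banach space with dual $X^*$. The Mackey topology $\mu(X^*,X)$ is the topology on $X^*$ of uniform convergence on the weakly compact subsets of $X$. A convex block subsequence of a sequence $(f_n)_{n\in\mathbb{N}}$ in a linear space is a sequence of the form $g_k=\sum_{n\in I_k}a_n f_n$ ($k\in\mathbb{N}$), where $(I_k)$ is a sequence of finite non-empty subsets of $\mathbb{N}$ with $\max(I_k)<\min(I_{k+1})$ and $(a_n)$ is a sequence of non-negative real numbers with $\sum_{n\in I_k}a_n=1$ for all $k\in\mathbb{N}$. The space $X$ has property (K) if every $w^*$-convergent sequence in $X^*$ admits a convex block subsequence which is $\mu(X^*,X)$-convergent. Let $\mathfrak{p}$ be the least cardinality of a family $\mathcal{M}$ of infinite subsets of $\mathbb{N}$ such that $\bigcap\mathcal{N}$ is infinite for every finite subfamily $\mathcal{N}\subseteq\mathcal{M}$, but there is no infinite set $A\subseteq\mathbb{N}$ such that $A\setminus M$ is finite for all $M\in\mathcal{M}$. **Theorem.** Let $\{X_i\}_{i\in I}$ be a collection of Banach spaces having property (K). If $|I|<\mathfrak{p}$, then the $\ell^1$-sum $\left(\bigoplus_{i\in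 I}X_i\right)_{\ell^1}$ has property (K). -/

import Mathlib

open Filter Topology Cardinal
open scoped ENNReal

universe u v

/-- `y` is a convex block subsequence of `x`: `y k = ∑ n ∈ I k, a n • x n`, where `(I k)` are finite
sets of indices with `max (I k) < min (I (k + 1))` and the `a n` are non-negative reals with
`∑ n ∈ I k, a n = 1` for all `k` (in particular every `I k` is non-empty). -/
def IsConvexBlockSubseq {E : Type*} [AddCommGroup E] [Module ℝ E] (y x : ℕ → E) : Prop :=
  ∃ (I : ℕ → Finset ℕ) (a : ℕ → ℝ),
    (∀ k, ∀ m ∈ I k, ∀ n ∈ I (k + 1), m < n) ∧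
    (∀ n, 0 ≤ a n) ∧
    (∀ k, ∑ n ∈ I k, a n = 1) ∧
    ∀ k, y k = ∑ n ∈ I k, a n • x n

/-- The family of all weakly compact subsets of `X`. -/
def weaklyCompactSets (X : Type*) [NormedAddCommGroup X] [NormedSpace ℝ X] : Set (Set X) :=
  {L | IsCompact (toWeakSpace ℝ X '' L)}

/-- The dual of `X` with the Mackey topology `μ(X*, X)`, i.e. the topology of uniform convergence
on the weakly compact subsets of `X`. -/
abbrev MackeyDual (X : Type*) [NormedAddCommGroup X] [NormedSpace ℝ X] : Type _ :=
  UniformConvergenceCLM (RingHom.id ℝ) (E := X) ℝ (weaklyCompactSets X)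

/-- A functional, viewed as an element of the dual with its Mackey topology. -/
noncomputable def toMackeyDual {X : Type*} [NormedAddCommGroup X] [NormedSpace ℝ X] (f : StrongDual ℝ X) :
    MackeyDual X :=
  UniformConvergenceCLM.ofFun (RingHom.id ℝ) ℝ (weaklyCompactSets X) f

theorem tendsto_toMackeyDual_iff {X : Type*} [NormedAddCommGroup X] [NormedSpace ℝ X]
    (y : ℕ → StrongDual ℝ X) (f : StrongDual ℝ X) :
    Tendsto (fun n => toMackeyDual (y n)) atTop (𝓝 (toMackeyDual f)) ↔
      ∀ L : Set X, IsCompact (toWeakSpace ℝ X '' L) →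
        TendstoUniformlyOn (fun n v => y n v) (fun v => f v) atTop L :=
  UniformConvergenceCLM.tendsto_iff_tendstoUniformlyOn (RingHom.id ℝ) ℝ (weaklyCompactSets X)

/-- Property (K): every weak-star convergent sequence in the dual of `X` admits a convex block
subsequence which converges in the Mackey topology. -/
def PropertyK (X : Type*) [NormedAddCommGroup X] [NormedSpace ℝ X] : Prop :=
  ∀ (x : ℕ → StrongDual ℝ X) (x₀ : StrongDual ℝ X),
    Tendsto (fun n => StrongDual.toWeakDual (x n)) atTop (𝓝 (StrongDual.toWeakDual x₀)) →
    ∃ y : ℕ → StrongDual ℝ X, IsConvexBlockSubseq y x ∧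
      ∃ y₀ : StrongDual ℝ X,
        Tendsto (fun n => toMackeyDual (y n)) atTop (𝓝 (toMackeyDual y₀))

/-- Families of infinite subsets of `ℕ` all of whose finite subfamilies have infinite intersection,
but for which there is no infinite set almost contained in each member. -/
def IsUnboundedCenteredFamily (M : Set (Set ℕ)) : Prop :=
  (∀ A ∈ M, A.Infinite) ∧
  (∀ N : Finset (Set ℕ), (N : Set (Set ℕ)) ⊆ M → (⋂ A ∈ N, A).Infinite) ∧
  ¬ ∃ A : Set ℕ, A.Infinite ∧ ∀ B ∈ M, (A \ B).Finite

/-- Such families exist (a non-principal ultrafilter is one), so the infimum below is a minimum. -/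
theorem exists_isUnboundedCenteredFamily : ∃ M : Set (Set ℕ), IsUnboundedCenteredFamily M := by
  have hinf : ∀ A ∈ (hyperfilter ℕ), A.Infinite := fun A hA hfin =>
    notMem_hyperfilter_of_finite hfin hA
  refine ⟨{A | A ∈ hyperfilter ℕ}, hinf, fun N hN => hinf _ ?_, ?_⟩
  · exact (Filter.biInter_finset_mem N).2 fun A hA => hN hA
  · rintro ⟨A, hA, h⟩
    obtain ⟨f, hf, hfA⟩ : ∃ f : ℕ → ℕ, StrictMono f ∧ ∀ n, f n ∈ A :=
      ⟨Nat.nth (· ∈ A), Nat.nth_strictMono hA, Nat.nth_mem_of_infinite hA⟩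
    have hinj := hf.injective
    have key : ∀ g : ℕ → ℕ, Function.Injective g → (∀ n, g n ∈ A) →
        (Set.range g)ᶜ ∉ hyperfilter ℕ := fun g hg hgA hmem =>
      (Set.infinite_range_of_injective hg) ((h _ hmem).subset (by
        rintro _ ⟨n, rfl⟩
        exact ⟨hgA n, fun hn => hn ⟨n, rfl⟩⟩))
    have h0 := key (fun n => f (2 * n)) (fun a b hab => by have := hinj hab; omega)
      (fun n => hfA _)
    have h1 := key (fun n => f (2 * n + 1)) (fun a b hab => by have := hinj hab; omega)
      (fun n => hfA _)
    rw [Ultrafilter.compl_mem_iff_notMem, not_not] at h0 h1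
    obtain ⟨_, ⟨a, rfl⟩, ⟨b, hb⟩⟩ := (hyperfilter ℕ).nonempty_of_mem (inter_mem h0 h1)
    have := hinj hb
    omega

/-- The pseudo-intersection number `𝔭`. -/
noncomputable def pseudoIntersectionNumber : Cardinal.{0} :=
  sInf {c | ∃ M : Set (Set ℕ), IsUnboundedCenteredFamily M ∧ #M = c}

/-! Convex block subsequences are awkward to diagonalise, so they are replaced by the preorder
`IsAlmostConvexSubseq`, which tolerates vanishing norm errors. It is preserved by bounded operators,
limits uniform on bounded sets pass down it, and `IsAlmostConvexSubseq.exists_convexBlock` returns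
to genuine blocks at the end. For each `i`, convergence of the `i`-th coordinates, uniform on weakly
compact sets, is hereditary for this preorder and, by property (K) of `X i`, attainable below every
sequence under `x`. A transfinite recursion over a well-order of the index set attains all these
properties at once; lower bounds exist because sequences can be coded by subsets of `ℕ`, using a
countable set dense in the span of `x`, and fewer than `𝔭` constraints have a pseudo-intersection.
Coordinatewise convergence suffices because weakly compact subsets of an `ℓ¹`-sum have uniformly
small tails (`exists_finset_norm_sub_sum_single_le`). Otherwise there would be disjointly supported
functionals, absolutely summable at each vector, staying away from zero along a weakly compact set,
which a gliding hump excludes. -/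

/-- Every tail of `z` has a convex hull to which the sequence `y` comes arbitrarily close. -/
def IsAlmostConvexSubseq {V : Type*} [NormedAddCommGroup V] [NormedSpace ℝ V] (y z : ℕ → V) :
    Prop :=
  ∀ ε > 0, ∀ J : ℕ, ∀ᶠ k in atTop,
    y k ∈ Metric.thickening ε (convexHull ℝ (z '' Set.Ici J))

/-! ### The preorder of approximate convex subsequences. -/

namespace IsAlmostConvexSubseq

variable {V W : Type*} [NormedAddCommGroup V] [NormedSpace ℝ V] [NormedAddCommGroup W]
  [NormedSpace ℝ W]

theorem refl (z : ℕ → V) : IsAlmostConvexSubseq z z := by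
  intro ε hε J
  filter_upwards [eventually_ge_atTop J] with k hk
  exact Metric.self_subset_thickening hε _ (subset_convexHull ℝ _ ⟨k, hk, rfl⟩)

/-- Thickenings of convex sets are convex, so an estimate on a tail of `z` extends to its hull. -/
theorem trans {y z w : ℕ → V} (h₁ : IsAlmostConvexSubseq y z) (h₂ : IsAlmostConvexSubseq z w) :
    IsAlmostConvexSubseq y w := by
  intro ε hε J
  obtain ⟨K, hK⟩ := eventually_atTop.1 (h₂ (ε / 2) (half_pos hε) J)
  filter_upwards [h₁ (ε / 2) (half_pos hε) K] with k hk
  have hsub : convexHull ℝ (z '' Set.Ici K) ⊆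
      Metric.thickening (ε / 2) (convexHull ℝ (w '' Set.Ici J)) := by
    refine convexHull_min ?_ ((convex_convexHull ℝ _).thickening _)
    rintro _ ⟨j, hj, rfl⟩
    exact hK j hj
  have := Metric.thickening_thickening_subset (ε / 2) (ε / 2) _
    (Metric.thickening_subset_of_subset (ε / 2) hsub hk)
  rwa [add_halves] at this

theorem of_convexBlock {y x : ℕ → V} (h : IsConvexBlockSubseq y x) :
    IsAlmostConvexSubseq y x := by
  obtain ⟨I, a, hlt, ha, hsum, hy⟩ := h
  have hge : ∀ k, ∀ n ∈ I k, k ≤ n := by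
    intro k
    induction k with
    | zero => intro n _; exact n.zero_le
    | succ k ih =>
      intro n hn
      have hne : (I k).Nonempty := by
        by_contra hemp
        have := hsum k
        rw [Finset.not_nonempty_iff_eq_empty.1 hemp] at this
        simp at this
      obtain ⟨m, hm⟩ := hne
      exact (ih m hm).trans_lt (hlt k m hm n hn)
  intro ε hε J
  filter_upwards [eventually_ge_atTop J] with k hk
  refine Metric.self_subset_thickening hε _ ?_
  rw [hy k]
  exact (convex_convexHull ℝ _).sum_mem (fun n _ => ha n) (hsum k) fun n hn =>
    subset_convexHull ℝ _ ⟨n, hk.trans (hge k n hn), rfl⟩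

theorem of_dist_tendsto {y z : ℕ → V} {m : ℕ → ℕ} (hm : ∀ k, k ≤ m k)
    (h : Tendsto (fun k => dist (y k) (z (m k))) atTop (𝓝 0)) : IsAlmostConvexSubseq y z := by
  intro ε hε J
  filter_upwards [eventually_ge_atTop J, h.eventually_lt_const hε] with k hk hk'
  exact Metric.mem_thickening_iff.2
    ⟨_, subset_convexHull ℝ _ ⟨m k, hk.trans (hm k), rfl⟩, hk'⟩

theorem map (T : V →L[ℝ] W) {y z : ℕ → V} (h : IsAlmostConvexSubseq y z) :
    IsAlmostConvexSubseq (fun n => T (y n)) (fun n => T (z n)) := by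
  intro ε hε J
  have hpos : 0 < ‖T‖ + 1 := by positivity
  filter_upwards [h (ε / (‖T‖ + 1)) (div_pos hε hpos) J] with k hk
  obtain ⟨p, hp, hpd⟩ := Metric.mem_thickening_iff.1 hk
  refine Metric.mem_thickening_iff.2 ⟨T p, ?_, ?_⟩
  · have : (fun n => T (z n)) '' Set.Ici J = T '' (z '' Set.Ici J) := by
      rw [Set.image_image]
    rw [this]
    exact (T.toLinearMap.image_convexHull _).subset ⟨p, hp, rfl⟩
  · rw [dist_eq_norm] at hpd ⊢
    rw [← map_sub]
    rw [lt_div_iff₀ hpos] at hpd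
    have h1 := T.le_opNorm (y k - p)
    nlinarith [norm_nonneg (y k - p)]

/-- Balls are convex, so the estimate at each `v` passes to hulls of tails; the bound `R` controls
the norm error uniformly on `L`. -/
theorem tendstoUniformlyOn {y z : ℕ → StrongDual ℝ V} {f : StrongDual ℝ V} {L : Set V} {R : ℝ}
    (hL : ∀ v ∈ L, ‖v‖ ≤ R) (h : IsAlmostConvexSubseq y z)
    (hz : TendstoUniformlyOn (fun n v => z n v) (fun v => f v) atTop L) :
    TendstoUniformlyOn (fun n v => y n v) (fun v => f v) atTop L := by
  rw [Metric.tendstoUniformlyOn_iff] at hz ⊢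
  intro ε hε
  obtain ⟨J, hJ⟩ := eventually_atTop.1 (hz (ε / 2) (half_pos hε))
  have hR : 0 < |R| + 1 := by positivity
  filter_upwards [h (ε / 2 / (|R| + 1)) (by positivity) J] with k hk v hv
  obtain ⟨p, hp, hpd⟩ := Metric.mem_thickening_iff.1 hk
  have hconv : Convex ℝ {g : StrongDual ℝ V | g v ∈ Metric.ball (f v) (ε / 2)} :=
    (convex_ball (f v) (ε / 2)).linear_preimage
      (ContinuousLinearMap.apply ℝ ℝ v : StrongDual ℝ V →L[ℝ] ℝ).toLinearMap
  have hpv : p v ∈ Metric.ball (f v) (ε / 2) := by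
    refine convexHull_min ?_ hconv hp
    rintro _ ⟨j, hj, rfl⟩
    have := hJ j hj v hv
    rwa [dist_comm] at this
  have h1 : dist (y k v) (p v) ≤ ε / 2 := by
    rw [dist_eq_norm] at hpd ⊢
    have h2 := (y k - p).le_opNorm v
    rw [lt_div_iff₀ hR] at hpd
    have h3 : ‖v‖ ≤ |R| + 1 := (hL v hv).trans ((le_abs_self R).trans (by linarith))
    have h4 : ‖y k - p‖ * ‖v‖ ≤ ‖y k - p‖ * (|R| + 1) := by gcongr
    exact (h2.trans h4).trans hpd.le
  have h5 : dist (p v) (f v) < ε / 2 := hpv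
  rw [dist_comm]
  linarith [dist_triangle (y k v) (p v) (f v)]

theorem tendsto_apply {y z : ℕ → StrongDual ℝ V} {f : StrongDual ℝ V} {v : V}
    (h : IsAlmostConvexSubseq y z) (hz : Tendsto (fun n => z n v) atTop (𝓝 (f v))) :
    Tendsto (fun n => y n v) atTop (𝓝 (f v)) := by
  have := h.tendstoUniformlyOn (L := {v}) (R := ‖v‖) (by simp) (f := f)
    (by rwa [tendstoUniformlyOn_singleton_iff_tendsto])
  rwa [tendstoUniformlyOn_singleton_iff_tendsto] at this

end IsAlmostConvexSubseq

/-! ### Returning to genuine convex blocks. -/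

theorem exists_finset_of_mem_convexHull_image {V : Type*} [AddCommGroup V] [Module ℝ V]
    {x : ℕ → V} {s : Set ℕ} {p : V} (hp : p ∈ convexHull ℝ (x '' s)) :
    ∃ (F : Finset ℕ) (a : ℕ → ℝ), (∀ n ∈ F, n ∈ s) ∧ (∀ n, 0 ≤ a n) ∧ ∑ n ∈ F, a n = 1 ∧
      ∑ n ∈ F, a n • x n = p := by
  rw [convexHull_eq] at hp
  obtain ⟨ι, t, w, z, hw, hw1, hz, rfl⟩ := hp
  classical
  choose! n hns hnz using hz
  refine ⟨t.image n, fun m => ∑ i ∈ t with n i = m, w i, ?_, ?_, ?_, ?_⟩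
  · intro m hm
    obtain ⟨i, hi, rfl⟩ := Finset.mem_image.1 hm
    exact hns i hi
  · exact fun m => Finset.sum_nonneg fun i hi => hw i (Finset.mem_filter.1 hi).1
  · rw [← hw1]
    exact Finset.sum_fiberwise_of_maps_to (fun i hi => Finset.mem_image_of_mem n hi) _
  · rw [Finset.centerMass_eq_of_sum_1 _ _ hw1,
      ← Finset.sum_fiberwise_of_maps_to (fun i hi => Finset.mem_image_of_mem n hi) (fun i => w i • z i)]
    refine Finset.sum_congr rfl fun m _ => ?_
    rw [Finset.sum_smul]
    refine Finset.sum_congr rfl fun i hi => ?_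
    obtain ⟨hi, hin⟩ := Finset.mem_filter.1 hi
    rw [← hnz i hi, hin]

/-- A sequence close to the convex hulls of the tails of `x` can be approximated by a convex block
subsequence of `x`. -/
theorem IsAlmostConvexSubseq.exists_convexBlock {V : Type*} [NormedAddCommGroup V]
    [NormedSpace ℝ V] {y x : ℕ → V} (h : IsAlmostConvexSubseq y x) :
    ∃ y' : ℕ → V, IsConvexBlockSubseq y' x ∧ IsAlmostConvexSubseq y' y := by
  have step : ∀ k N : ℕ, ∃ (F : Finset ℕ) (a : ℕ → ℝ) (m : ℕ), (∀ n ∈ F, N ≤ n) ∧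
      (∀ n, 0 ≤ a n) ∧ ∑ n ∈ F, a n = 1 ∧ k ≤ m ∧
      dist (∑ n ∈ F, a n • x n) (y m) < 1 / ((k : ℝ) + 1) := by
    intro k N
    obtain ⟨m, hm, hkm⟩ := ((h (1 / ((k : ℝ) + 1)) (by positivity) N).and
      (eventually_ge_atTop k)).exists
    obtain ⟨p, hp, hd⟩ := Metric.mem_thickening_iff.1 hm
    obtain ⟨F, a, hF, ha, ha1, rfl⟩ := exists_finset_of_mem_convexHull_image hp
    exact ⟨F, a, m, hF, ha, ha1, hkm, by rwa [dist_comm]⟩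
  choose F a m hF ha ha1 hm hd using step
  -- `N k` exceeds every index used by the blocks before the `k`-th.
  let N : ℕ → ℕ := fun k => Nat.rec 0 (fun k N => max N ((F k N).sup id + 1)) k
  have hN : ∀ k, N (k + 1) = max (N k) ((F k (N k)).sup id + 1) := fun k => rfl
  have hNmono : Monotone N := monotone_nat_of_le_succ fun k => by rw [hN]; exact le_max_left _ _
  have hFlt : ∀ k, ∀ n ∈ F k (N k), n < N (k + 1) := by
    intro k n hn
    have : n ≤ (F k (N k)).sup id := Finset.le_sup (f := id) hn
    rw [hN]
    exact (Nat.lt_succ_of_le this).trans_le (le_max_right _ _)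
  have huniq : ∀ k l n, n ∈ F k (N k) → n ∈ F l (N l) → k = l := by
    intro k l n hk hl
    by_contra hne
    rcases lt_or_gt_of_ne hne with hlt | hlt
    · exact absurd ((hFlt k n hk).trans_le (hNmono (Nat.succ_le_of_lt hlt)))
        (not_lt.2 (hF l _ n hl))
    · exact absurd ((hFlt l n hl).trans_le (hNmono (Nat.succ_le_of_lt hlt)))
        (not_lt.2 (hF k _ n hk))
  classical
  -- The blocks are disjoint, so their weights glue to one function; the value `0` elsewhere is
  -- never used.
  let b : ℕ → ℝ := fun n => if hn : ∃ k, n ∈ F k (N k) then a hn.choose (N hn.choose) n else 0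
  have hb : ∀ k, ∀ n ∈ F k (N k), b n = a k (N k) n := by
    intro k n hn
    have hex : ∃ k, n ∈ F k (N k) := ⟨k, hn⟩
    have : hex.choose = k := huniq _ _ n hex.choose_spec hn
    simp only [b, dif_pos hex]
    rw [this]
  refine ⟨fun k => ∑ n ∈ F k (N k), b n • x n, ⟨fun k => F k (N k), b, ?_, ?_, ?_, fun k => rfl⟩, ?_⟩
  · exact fun k i hi j hj => (hFlt k i hi).trans_le (hF _ _ j hj)
  · intro n
    by_cases hn : ∃ k, n ∈ F k (N k)
    · simp only [b, dif_pos hn]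
      exact ha _ _ _
    · simp only [b, dif_neg hn, le_refl]
  · intro k
    rw [Finset.sum_congr rfl (hb k), ha1]
  · refine IsAlmostConvexSubseq.of_dist_tendsto (m := fun k => m k (N k)) (fun k => hm _ _) ?_
    refine squeeze_zero (fun _ => dist_nonneg) (fun k => ?_) tendsto_one_div_add_atTop_nhds_zero_nat
    rw [Finset.sum_congr rfl fun n hn => by rw [hb k n hn]]
    exact (hd k (N k)).le

/-! ### Pseudo-intersections and lower bounds. -/

theorem exists_pseudoIntersection_of_countable (A : ℕ → Set ℕ)
    (hA : ∀ F : Finset ℕ, (⋂ n ∈ F, A n).Infinite) :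
    ∃ B : Set ℕ, B.Infinite ∧ ∀ n, (B \ A n).Finite := by
  obtain ⟨φ, hφ, hmem⟩ := extraction_forall_of_frequently
    (P := fun n k => k ∈ ⋂ m ∈ Finset.range (n + 1), A m)
    (fun n => Nat.frequently_atTop_iff_infinite.2 (hA (Finset.range (n + 1))))
  refine ⟨Set.range φ, Set.infinite_range_of_injective hφ.injective, fun n => ?_⟩
  refine ((Set.finite_lt_nat n).image φ).subset ?_
  rintro _ ⟨⟨m, rfl⟩, hm⟩
  refine ⟨m, ?_, rfl⟩
  by_contra hmn
  have hmn : n ≤ m := not_lt.1 hmn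
  exact hm (Set.mem_iInter₂.1 (hmem m) n (Finset.mem_range.2 (Nat.lt_succ_of_le hmn)))

theorem IsUnboundedCenteredFamily.aleph0_lt {M : Set (Set ℕ)} (hM : IsUnboundedCenteredFamily M) :
    ℵ₀ < #M := by
  by_contra hle
  have hc : M.Countable := Cardinal.le_aleph0_iff_set_countable.1 (not_lt.1 hle)
  rcases M.eq_empty_or_nonempty with rfl | hne
  · exact hM.2.2 ⟨Set.univ, Set.infinite_univ, by simp⟩
  obtain ⟨A, rfl⟩ := hc.exists_eq_range hne
  classical
  obtain ⟨B, hB, hBA⟩ := exists_pseudoIntersection_of_countable A fun F => by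
    have := hM.2.1 (F.image A) (by
      rw [Finset.coe_image]
      exact Set.image_subset_range _ _)
    rwa [Finset.set_biInter_finset_image] at this
  exact hM.2.2 ⟨B, hB, by rintro _ ⟨n, rfl⟩; exact hBA n⟩

/-- Uncountability of `𝔭` leaves room for countably many accuracy levels per index. -/
theorem aleph0_lt_pseudoIntersectionNumber : ℵ₀ < pseudoIntersectionNumber := by
  obtain ⟨M, hM, hMp⟩ := csInf_mem (s := {c | ∃ M : Set (Set ℕ), IsUnboundedCenteredFamily M ∧
    #M = c}) (by
      obtain ⟨M, hM⟩ := exists_isUnboundedCenteredFamily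
      exact ⟨_, M, hM, rfl⟩)
  rw [pseudoIntersectionNumber, ← hMp]
  exact hM.aleph0_lt

theorem exists_pseudoIntersection {ι : Type u} (A : ι → Set ℕ)
    (hι : #ι < Cardinal.lift.{u} pseudoIntersectionNumber)
    (hA : ∀ F : Finset ι, (⋂ i ∈ F, A i).Infinite) :
    ∃ B : Set ℕ, B.Infinite ∧ ∀ i, (B \ A i).Finite := by
  by_contra hcon
  have hM : IsUnboundedCenteredFamily (Set.range A) := by
    refine ⟨?_, fun N hN => ?_, ?_⟩
    · rintro _ ⟨i, rfl⟩
      simpa using hA {i}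
    · classical
      obtain ⟨F, -, rfl⟩ := (Finset.subset_set_image_iff (s := Set.univ) (f := A)).1
        (by rwa [Set.image_univ])
      have := hA F
      rwa [← Finset.set_biInter_finset_image (f := A) (g := fun B => B)] at this
    · rintro ⟨B, hB, h⟩
      exact hcon ⟨B, hB, fun i => h _ ⟨i, rfl⟩⟩
  have h1 : pseudoIntersectionNumber ≤ #(Set.range A) := csInf_le' ⟨_, hM, rfl⟩
  have h2 : Cardinal.lift.{u} #(Set.range A) ≤ #ι := by
    simpa using Cardinal.mk_range_le_lift (f := A)
  exact absurd ((Cardinal.lift_le.2 h1).trans h2) (not_le.2 hι)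

/-- Fewer than `𝔭` sequences, any finitely many of which have a common lower bound below `x`, have
a common lower bound below `x`. -/
theorem exists_isAlmostConvexSubseq_forall {V : Type*} [NormedAddCommGroup V] [NormedSpace ℝ V]
    (x : ℕ → V) {S : Type u} (z : S → ℕ → V)
    (hS : #S < Cardinal.lift.{u} pseudoIntersectionNumber)
    (hz : ∀ F : Finset S, ∃ w, IsAlmostConvexSubseq w x ∧ ∀ s ∈ F, IsAlmostConvexSubseq w (z s)) :
    ∃ w, IsAlmostConvexSubseq w x ∧ ∀ s, IsAlmostConvexSubseq w (z s) := by
  obtain ⟨Q, hQc, hQ⟩ := (Set.countable_range x).isSeparable.span (R := ℝ)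
  have hxQ : convexHull ℝ (x '' Set.Ici 0) ⊆ closure Q := fun p hp => hQ (convexHull_min
    ((Set.image_subset_range _ _).trans Submodule.subset_span) (Submodule.convex _) hp)
  have hQne : Q.Nonempty := by
    rw [← closure_nonempty_iff]
    exact ⟨x 0, hxQ (subset_convexHull ℝ _ ⟨0, Set.mem_Ici.2 le_rfl, rfl⟩)⟩
  obtain ⟨q, rfl⟩ := hQc.exists_eq_range hQne
  -- `none` adds `x` itself to the constraints.
  let z' : Option S → ℕ → V := fun s => s.elim x z
  -- A number codes a position and a point of the dense set. The position makes a single good point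
  -- yield infinitely many codes.
  let A : Option S × ℕ → Set ℕ := fun a => {n | a.2 ≤ n.unpair.1 ∧
    q n.unpair.2 ∈ Metric.thickening (1 / ((a.2 : ℝ) + 1)) (convexHull ℝ (z' a.1 '' Set.Ici a.2))}
  have hp : ℵ₀ < Cardinal.lift.{u} pseudoIntersectionNumber := by
    rw [← Cardinal.lift_aleph0.{u, 0}, Cardinal.lift_lt]
    exact aleph0_lt_pseudoIntersectionNumber
  have hcard : #(Option S × ℕ) < Cardinal.lift.{u} pseudoIntersectionNumber := by
    rw [Cardinal.mk_prod, Cardinal.mk_option, Cardinal.mk_nat, Cardinal.lift_aleph0,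
      Cardinal.lift_uzero]
    exact Cardinal.mul_lt_of_lt hp.le
      (Cardinal.add_lt_of_lt hp.le hS (Cardinal.one_lt_aleph0.trans hp)) hp
  obtain ⟨B, hB, hBA⟩ := exists_pseudoIntersection A hcard fun F => by
    classical
    obtain ⟨w, hwx, hw⟩ := hz (F.image Prod.fst).eraseNone
    have hw' : ∀ a ∈ F, IsAlmostConvexSubseq w (z' a.1) := by
      rintro ⟨_ | s, J⟩ ha
      · exact hwx
      · exact hw s (Finset.mem_eraseNone.2 (Finset.mem_image_of_mem Prod.fst ha))
    have hev : ∀ᶠ k in atTop, ∀ a ∈ F, w k ∈ Metric.thickening (1 / ((a.2 : ℝ) + 1) / 2)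
        (convexHull ℝ (z' a.1 '' Set.Ici a.2)) :=
      (Finset.eventually_all F).2 fun a ha => hw' a ha _ (by positivity) _
    -- An error below `δ` in replacing `w k` by a dense point fits in the remaining half of every
    -- tolerance.
    have hδ : ∃ δ > 0, ∀ a ∈ F, δ < 1 / ((a.2 : ℝ) + 1) / 2 := by
      refine ⟨1 / ((F.sup Prod.snd : ℕ) + 1 : ℝ) / 4, by positivity, fun a ha => ?_⟩
      have h1 : (a.2 : ℝ) ≤ (F.sup Prod.snd : ℕ) := by exact_mod_cast Finset.le_sup (f := Prod.snd) ha
      have h2 : 1 / ((F.sup Prod.snd : ℕ) + 1 : ℝ) ≤ 1 / ((a.2 : ℝ) + 1) := by gcongr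
      have h3 : 0 < 1 / ((a.2 : ℝ) + 1) := by positivity
      linarith
    obtain ⟨δ, hδ0, hδ⟩ := hδ
    obtain ⟨k, hk, hkx⟩ := (hev.and (hwx (δ / 2) (half_pos hδ0) 0)).exists
    obtain ⟨p, hp, hpd⟩ := Metric.mem_thickening_iff.1 hkx
    obtain ⟨_, ⟨m, rfl⟩, hm⟩ := Metric.mem_closure_iff.1 (hxQ hp) (δ / 2) (half_pos hδ0)
    refine Set.infinite_of_injective_forall_mem
      (f := fun n => Nat.pair (n + F.sup Prod.snd) m) (fun n n' h => ?_) fun n => ?_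
    · have := (Nat.pair_eq_pair.1 h).1
      omega
    · refine Set.mem_iInter₂.2 fun a ha => ?_
      simp only [A, Set.mem_ofPred_eq, Nat.unpair_pair]
      refine ⟨(Finset.le_sup (f := Prod.snd) ha).trans (Nat.le_add_left _ _), ?_⟩
      obtain ⟨r, hr, hrd⟩ := Metric.mem_thickening_iff.1 (hk a ha)
      refine Metric.mem_thickening_iff.2 ⟨r, hr, ?_⟩
      have h1 := dist_triangle (q m) (w k) r
      have h2 := dist_triangle_left (q m) (w k) p
      rw [dist_comm p (w k)] at h2
      linarith [hδ a ha]
  let φ := Nat.nth (· ∈ B)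
  have hφ : StrictMono φ := Nat.nth_strictMono hB
  have hev : ∀ a, ∀ᶠ k in atTop, φ k ∈ A a := by
    intro a
    have hfin : {k | φ k ∉ A a}.Finite := by
      refine Set.Finite.of_finite_image ((hBA a).subset ?_) hφ.injective.injOn
      rintro _ ⟨k, hk, rfl⟩
      exact ⟨Nat.nth_mem_of_infinite hB k, hk⟩
    have := hfin.eventually_cofinite_notMem
    rw [Nat.cofinite_eq_atTop] at this
    filter_upwards [this] with k hk
    exact not_not.1 hk
  have key : ∀ s : Option S, IsAlmostConvexSubseq (fun k => q (φ k).unpair.2) (z' s) := by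
    intro s ε hε J
    obtain ⟨K, hK⟩ := exists_nat_one_div_lt hε
    filter_upwards [hev (s, max J K)] with k hk
    refine Metric.thickening_mono ?_ _ (Metric.thickening_subset_of_subset _ ?_ hk.2)
    · refine le_trans ?_ hK.le
      have : (K : ℝ) ≤ (max J K : ℕ) := by exact_mod_cast le_max_right J K
      gcongr
    · exact convexHull_mono (Set.image_mono (Set.Ici_subset_Ici.2 (le_max_left J K)))
  exact ⟨_, key none, fun s => key (some s)⟩

/-! ### Transfinite diagonalisation. -/

/-- Simultaneous diagonalisation: fewer than `𝔭` hereditary properties, each of which can be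
attained below every sequence, can be attained all at once. -/
theorem exists_isAlmostConvexSubseq_forall_property {V : Type*} [NormedAddCommGroup V]
    [NormedSpace ℝ V] (x : ℕ → V) {I : Type u}
    (hI : #I < Cardinal.lift.{u} pseudoIntersectionNumber) (D : I → (ℕ → V) → Prop)
    (hmono : ∀ i y z, IsAlmostConvexSubseq y z → D i z → D i y)
    (hdense : ∀ i z, IsAlmostConvexSubseq z x → ∃ y, IsAlmostConvexSubseq y z ∧ D i y) :
    ∃ y, IsAlmostConvexSubseq y x ∧ ∀ i, D i y := by
  classical
  obtain ⟨r, hr⟩ := exists_wellFoundedLT I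
  -- The fallback `x` never occurs: `key` shows inductively that the condition always holds.
  let G : ∀ i : I, (∀ j, j < i → (ℕ → V)) → (ℕ → V) := fun i g =>
    if h : ∃ y, IsAlmostConvexSubseq y x ∧ D i y ∧ ∀ j (hj : j < i), IsAlmostConvexSubseq y (g j hj)
    then h.choose else x
  let f : I → ℕ → V := (wellFounded_lt (α := I)).fix G
  have hf : ∀ i, f i = G i fun j _ => f j := fun i => WellFounded.fix_eq _ _ _
  have bound : ∀ {S : Set I}, (∀ i ∈ S, IsAlmostConvexSubseq (f i) x) →
      (∀ i ∈ S, ∀ j < i, IsAlmostConvexSubseq (f i) (f j)) →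
      ∃ w, IsAlmostConvexSubseq w x ∧ ∀ i ∈ S, IsAlmostConvexSubseq w (f i) := by
    intro S hSx hS
    obtain ⟨w, hwx, hw⟩ := exists_isAlmostConvexSubseq_forall x (fun s : S => f s)
      ((Cardinal.mk_set_le S).trans_lt hI) fun F => by
        rcases F.eq_empty_or_nonempty with rfl | hF
        · exact ⟨x, .refl x, by simp⟩
        -- The family descends along the well-order, so the last member of a finite subfamily lies
        -- below the others.
        · refine ⟨f (F.max' hF), hSx _ (F.max' hF).2, fun s hs => ?_⟩
          rcases (F.le_max' s hs).eq_or_lt with h | h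
          · rw [← h]
            exact .refl _
          · exact hS _ (F.max' hF).2 _ h
    exact ⟨w, hwx, fun i hi => hw ⟨i, hi⟩⟩
  have key : ∀ i, IsAlmostConvexSubseq (f i) x ∧ D i (f i) ∧
      ∀ j < i, IsAlmostConvexSubseq (f i) (f j) := by
    intro i
    induction i using WellFoundedLT.induction with
    | ind i ih =>
      obtain ⟨w, hwx, hw⟩ := bound (S := Set.Iio i) (fun j hj => (ih j hj).1)
        (fun j hj => (ih j hj).2.2)
      obtain ⟨y, hyw, hy⟩ := hdense i w hwx
      have hex : ∃ y, IsAlmostConvexSubseq y x ∧ D i y ∧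
          ∀ j (_ : j < i), IsAlmostConvexSubseq y (f j) :=
        ⟨y, hyw.trans hwx, hy, fun j hj => hyw.trans (hw j hj)⟩
      rw [hf i]
      simp only [G, dif_pos hex]
      exact hex.choose_spec
  obtain ⟨w, hwx, hw⟩ := bound (S := Set.univ) (fun i _ => (key i).1) (fun i _ => (key i).2.2)
  exact ⟨w, hwx, fun i => hmono i _ _ (hw i trivial) (key i).2.1⟩

/-! ### Weakly compact sets and the gliding hump. -/

section WeaklyCompact

variable {E F : Type*} [NormedAddCommGroup E] [NormedSpace ℝ E] [NormedAddCommGroup F]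
  [NormedSpace ℝ F]

theorem continuous_apply_toWeakSpace_symm (f : StrongDual ℝ E) :
    Continuous fun x : WeakSpace ℝ E => f ((toWeakSpace ℝ E).symm x) :=
  WeakBilin.eval_continuous (topDualPairing ℝ E).flip f

theorem exists_norm_le_of_isCompact_toWeakSpace {K : Set E}
    (hK : IsCompact (toWeakSpace ℝ E '' K)) : ∃ R, ∀ v ∈ K, ‖v‖ ≤ R := by
  obtain ⟨R, hR⟩ := banach_steinhaus
    (g := fun v : K => NormedSpace.inclusionInDoubleDual ℝ E v) fun f => by
      obtain ⟨C, hC⟩ := (hK.image (continuous_apply_toWeakSpace_symm f)).isBounded.exists_norm_le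
      refine ⟨C, fun v => ?_⟩
      have := hC (f v) ⟨toWeakSpace ℝ E v, ⟨v, v.2, rfl⟩, by simp⟩
      simpa using this
  refine ⟨R, fun v hv => ?_⟩
  have := hR ⟨v, hv⟩
  rwa [show ‖NormedSpace.inclusionInDoubleDual ℝ E v‖ = ‖v‖ from
    (NormedSpace.inclusionInDoubleDualLi ℝ (E := E)).norm_map v] at this

theorem isCompact_toWeakSpace_image {K : Set E} (hK : IsCompact (toWeakSpace ℝ E '' K))
    (T : E →L[ℝ] F) : IsCompact (toWeakSpace ℝ F '' (T '' K)) := by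
  have := hK.image (WeakSpace.map T).continuous
  rw [Set.image_image] at this ⊢
  exact this

/-- Limits along one free ultrafilter serve all functionals at once, so no weakly convergent
subsequence is needed. -/
theorem exists_tendsto_hyperfilter {K : Set E} (hK : IsCompact (toWeakSpace ℝ E '' K))
    {v : ℕ → E} (hv : ∀ n, v n ∈ K) :
    ∃ u ∈ K, ∀ f : StrongDual ℝ E, Tendsto (fun n => f (v n)) (hyperfilter ℕ) (𝓝 (f u)) := by
  obtain ⟨_, ⟨u, hu, rfl⟩, hle⟩ := hK.ultrafilter_le_nhds'
    ((hyperfilter ℕ).map fun n => toWeakSpace ℝ E (v n))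
    (Ultrafilter.mem_map.2 (Filter.univ_mem' fun n => ⟨v n, hv n, rfl⟩))
  refine ⟨u, hu, fun f => ?_⟩
  have h1 : Tendsto (fun n => toWeakSpace ℝ E (v n)) (hyperfilter ℕ) (𝓝 (toWeakSpace ℝ E u)) := hle
  simpa [Function.comp_def] using ((continuous_apply_toWeakSpace_symm f).tendsto _).comp h1

/-- A functional representing the sum of a subsequence of an absolutely summable sequence of
functionals. -/
theorem exists_strongDual_hasSum {g : ℕ → StrongDual ℝ E} {C : ℝ}
    (hg : ∀ (v : E) (A : Finset ℕ), ∑ n ∈ A, |g n v| ≤ C * ‖v‖) :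
    ∃ h : StrongDual ℝ E, ∀ v, HasSum (fun n => g n v) (h v) := by
  have hs : ∀ v, Summable fun n => |g n v| := fun v =>
    summable_of_sum_le (fun n => abs_nonneg _) (hg v)
  have hs' : ∀ v, Summable fun n => g n v := fun v => (hs v).of_abs
  refine ⟨LinearMap.mkContinuous
    { toFun := fun v => ∑' n, g n v
      map_add' := fun v w => by simp only [map_add]; exact (hs' v).tsum_add (hs' w)
      map_smul' := fun c v => by simp [tsum_mul_left] } C fun v => ?_, fun v => (hs' v).hasSum⟩
  calc ‖∑' n, g n v‖ ≤ ∑' n, ‖g n v‖ := norm_tsum_le_tsum_norm (hs v)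
    _ ≤ C * ‖v‖ := (hs v).tsum_le_of_sum_le (hg v)

/-- A sequence of functionals which is absolutely summable, uniformly on the unit ball, cannot stay
away from zero on a weakly compact set. -/
theorem exists_abs_apply_le_of_isCompact_toWeakSpace {g : ℕ → StrongDual ℝ E} {C : ℝ}
    (hg : ∀ (v : E) (A : Finset ℕ), ∑ n ∈ A, |g n v| ≤ C * ‖v‖) {K : Set E}
    (hK : IsCompact (toWeakSpace ℝ E '' K)) {ε : ℝ} (hε : 0 < ε) {v : ℕ → E} (hv : ∀ n, v n ∈ K) :
    ∃ n, |g n (v n)| ≤ ε := by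
  by_contra! hcon
  have hs : ∀ v, Summable fun n => |g n v| := fun v =>
    summable_of_sum_le (fun n => abs_nonneg _) (hg v)
  obtain ⟨u, -, hu⟩ := exists_tendsto_hyperfilter hK hv
  let P : ℕ → Prop := fun j => ε / 2 ≤ |g j (v j - u)|
  -- Hump conditions: earlier functionals are small at later vectors, with geometric bounds, and
  -- later functionals have small total mass at earlier vectors.
  let r : ℕ → ℕ → Prop := fun j j' => j < j' ∧ |g j (v j' - u)| ≤ ε / 16 * (1 / 2) ^ j ∧
    ∀ A : Finset ℕ, (∀ n ∈ A, j' ≤ n) → ∑ n ∈ A, |g n (v j - u)| ≤ ε / 8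
  have hPev : ∀ᶠ j in atTop, P j := by
    filter_upwards [(hs u).tendsto_atTop_zero.eventually_lt_const (half_pos hε)] with j hj
    have := abs_sub_abs_le_abs_sub (g j (v j)) (g j u)
    rw [← map_sub] at this
    change ε / 2 ≤ |g j (v j - u)|
    linarith [hcon j]
  have hrev : ∀ j, ∀ᶠ j' in (hyperfilter ℕ : Filter ℕ), r j j' := by
    intro j
    have h1 : ∀ᶠ j' in (hyperfilter ℕ : Filter ℕ), j < j' :=
      Nat.hyperfilter_le_atTop (eventually_gt_atTop j)
    have h2 : ∀ᶠ j' in (hyperfilter ℕ : Filter ℕ), |g j (v j' - u)| ≤ ε / 16 * (1 / 2) ^ j := by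
      have : Tendsto (fun j' => |g j (v j' - u)|) (hyperfilter ℕ) (𝓝 0) := by
        have := ((hu (g j)).sub_const (g j u)).abs
        simpa using this
      filter_upwards [this.eventually_lt_const (by positivity : 0 < ε / 16 * (1 / 2) ^ j)] with j' h
      exact h.le
    have h3 : ∀ᶠ j' in atTop, ∀ A : Finset ℕ, (∀ n ∈ A, j' ≤ n) →
        ∑ n ∈ A, |g n (v j - u)| ≤ ε / 8 := by
      obtain ⟨S, hS⟩ := (summable_iff_vanishing_norm.1 (hs (v j - u))) (ε / 8) (by positivity)
      filter_upwards [eventually_gt_atTop (S.sup id)] with j' hj' A hA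
      refine (le_abs_self _).trans (hS A ?_).le
      rw [Finset.disjoint_left]
      intro n hn hnS
      have : n ≤ S.sup id := Finset.le_sup (f := id) hnS
      have := hA n hn
      omega
    filter_upwards [h1, h2, Nat.hyperfilter_le_atTop h3] with j' a b c using ⟨a, b, c⟩
  obtain ⟨j, hjP, hjr⟩ := exists_seq_of_forall_finset_exists P r fun s _ =>
    ((hPev.filter_mono Nat.hyperfilter_le_atTop).and ((Finset.eventually_all s).2 fun x _ => hrev x)).exists
  have hjmono : StrictMono j := fun m n hmn => (hjr m n hmn).1
  obtain ⟨h, hh⟩ := exists_strongDual_hasSum (g := fun m => g (j m)) (C := C) fun w A => by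
    have := hg w (A.map ⟨j, hjmono.injective⟩)
    simpa using this
  -- The subsequence gets its own limit `u'`, which need not be `u`. The sum `h` will be at least `ε
  -- / 4` at `u' - u` by passing to the limit, yet at most `ε / 8` term by term.
  obtain ⟨u', -, hu'⟩ := exists_tendsto_hyperfilter hK fun m => hv (j m)
  have hgeom : ∀ A : Finset ℕ, ∑ m ∈ A, ε / 16 * (1 / 2 : ℝ) ^ j m ≤ ε / 8 := by
    intro A
    have h1 : ∑ m ∈ A, ε / 16 * (1 / 2 : ℝ) ^ j m ≤ ∑ m ∈ A, ε / 16 * (1 / 2 : ℝ) ^ m := by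
      refine Finset.sum_le_sum fun m _ => ?_
      have := pow_le_pow_of_le_one (by norm_num : (0 : ℝ) ≤ 1 / 2) (by norm_num) (hjmono.id_le m)
      simp only [id] at this
      gcongr
    have h2 : ∑ m ∈ A, (1 / 2 : ℝ) ^ m ≤ 2 :=
      (summable_geometric_two.sum_le_tsum A fun _ _ => by positivity).trans tsum_geometric_two.le
    rw [← Finset.mul_sum (f := fun m => (1 / 2 : ℝ) ^ m)] at h1
    nlinarith
  -- The diagonal term is at least `ε / 2`; the terms before and after it contribute at most `ε / 8`
  -- each.
  have hlower : ∀ l, ε / 4 ≤ |h (v (j l) - u)| := by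
    intro l
    have hsum : |h (v (j l) - u) - g (j l) (v (j l) - u)| ≤ ε / 4 := by
      have htend : Tendsto (fun A : Finset ℕ => |∑ m ∈ A, g (j m) (v (j l) - u) -
          g (j l) (v (j l) - u)|) atTop (𝓝 |h (v (j l) - u) - g (j l) (v (j l) - u)|) :=
        ((hh (v (j l) - u)).sub_const _).abs
      refine le_of_tendsto htend ?_
      filter_upwards [eventually_ge_atTop {l}] with A hA
      have hlA : l ∈ A := hA (Finset.mem_singleton_self l)
      rw [← Finset.add_sum_erase A _ hlA, add_sub_cancel_left]
      refine (Finset.abs_sum_le_sum_abs _ _).trans ?_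
      rw [← Finset.sum_filter_add_sum_filter_not (A.erase l) (· < l)]
      have h1 : ∑ m ∈ A.erase l with m < l, |g (j m) (v (j l) - u)| ≤ ε / 8 :=
        (Finset.sum_le_sum fun m hm => (hjr m l (Finset.mem_filter.1 hm).2).2.1).trans (hgeom _)
      have h2 : ∑ m ∈ A.erase l with ¬ m < l, |g (j m) (v (j l) - u)| ≤ ε / 8 := by
        have := (hjr l (l + 1) l.lt_succ_self).2.2
          ((Finset.filter (fun m => ¬ m < l) (A.erase l)).map ⟨j, hjmono.injective⟩) fun n hn => by
            obtain ⟨m, hm, rfl⟩ := Finset.mem_map.1 hn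
            rw [Finset.mem_filter, Finset.mem_erase] at hm
            exact hjmono.monotone (by omega)
        simpa only [Finset.sum_map, Function.Embedding.coeFn_mk] using this
      linarith
    have := abs_sub_abs_le_abs_sub (g (j l) (v (j l) - u)) (h (v (j l) - u))
    rw [abs_sub_comm] at this
    have hP : ε / 2 ≤ |g (j l) (v (j l) - u)| := hjP l
    linarith
  have hge : ε / 4 ≤ |h (u' - u)| := by
    have : Tendsto (fun l => |h (v (j l) - u)|) (hyperfilter ℕ) (𝓝 |h (u' - u)|) := by
      simp only [map_sub]
      exact ((hu' h).sub_const _).abs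
    exact ge_of_tendsto this (Eventually.of_forall hlower)
  have hle : |h (u' - u)| ≤ ε / 8 := by
    refine le_of_tendsto (hh (u' - u)).abs (Eventually.of_forall fun A => ?_)
    refine (Finset.abs_sum_le_sum_abs _ _).trans ((Finset.sum_le_sum fun m _ => ?_).trans (hgeom A))
    have : Tendsto (fun l => |g (j m) (v (j l) - u)|) (hyperfilter ℕ)
        (𝓝 |g (j m) (u' - u)|) := by
      simp only [map_sub]
      exact ((hu' (g (j m))).sub_const _).abs
    refine le_of_tendsto this (Nat.hyperfilter_le_atTop ?_)
    filter_upwards [eventually_gt_atTop m] with l hl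
    exact (hjr m l hl).2.1
  linarith

end WeaklyCompact

/-! ### Tails of weakly compact sets in `ℓ¹`-sums. -/

theorem lp.hasSum_norm_one {I : Type u} {X : I → Type v} [∀ i, NormedAddCommGroup (X i)]
    (f : lp X 1) : HasSum (fun i => ‖f i‖) ‖f‖ := by
  simpa using lp.hasSum_norm (p := 1) (by simp) f

section Sum

variable {I : Type u} {X : I → Type v} [∀ i, NormedAddCommGroup (X i)] [∀ i, NormedSpace ℝ (X i)]

/-- Weakly compact subsets of an `ℓ¹`-sum have uniformly small tails. -/
theorem exists_finset_norm_sub_sum_single_le [DecidableEq I] {K : Set (lp X 1)}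
    (hK : IsCompact (toWeakSpace ℝ (lp X 1) '' K)) {ε : ℝ} (hε : 0 < ε) :
    ∃ J : Finset I, ∀ v ∈ K, ‖v - ∑ i ∈ J, lp.single 1 i (v i)‖ ≤ ε := by
  by_contra! hcon
  have step : ∀ J : Finset I, ∃ v ∈ K, ∃ F : Finset I, Disjoint J F ∧ ε < ∑ i ∈ F, ‖v i‖ := by
    intro J
    obtain ⟨v, hv, hvJ⟩ := hcon J
    have h1 := lp.norm_compl_sum_single (p := 1) (by simp) v J
    simp only [ENNReal.toReal_one, Real.rpow_one] at h1
    have h2 : ε + ∑ i ∈ J, ‖v i‖ < ‖v‖ := by linarith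
    obtain ⟨F, hJF, hF⟩ := (((lp.hasSum_norm_one v).eventually (lt_mem_nhds h2)).and
      (eventually_ge_atTop J)).exists.imp fun F h => h.symm
    refine ⟨v, hv, F \ J, Finset.disjoint_sdiff, ?_⟩
    have := Finset.sum_sdiff (f := fun i => ‖v i‖) hJF
    linarith
  obtain ⟨a, ha, hadisj⟩ := exists_seq_of_forall_finset_exists
    (fun a : lp X 1 × Finset I => a.1 ∈ K ∧ ε < ∑ i ∈ a.2, ‖a.1 i‖)
    (fun a b => Disjoint a.2 b.2) fun s _ => by
      obtain ⟨v, hv, F, hF, hvF⟩ := step (s.biUnion Prod.snd)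
      exact ⟨(v, F), ⟨hv, hvF⟩, fun x hx => hF.mono_left (Finset.subset_biUnion_of_mem _ hx)⟩
  have hpair : Pairwise (Function.onFun Disjoint fun n => (a n).2) := by
    intro m n hmn
    rcases lt_or_gt_of_ne hmn with h | h
    · exact hadisj _ _ h
    · exact (hadisj _ _ h).symm
  -- Norming functionals on disjoint blocks give `∑ |g n v| ≤ ‖v‖` while `g n` exceeds `ε` at the
  -- `n`-th chosen vector.
  choose ψ hψ1 hψ using fun (n : ℕ) (i : I) => exists_dual_vector'' ℝ ((a n).1 i)
  let g : ℕ → StrongDual ℝ (lp X 1) := fun n =>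
    ∑ i ∈ (a n).2, (ψ n i).comp (lp.evalCLM ℝ X 1 i)
  have hgapp : ∀ n v, g n v = ∑ i ∈ (a n).2, ψ n i (v i) := by
    intro n v
    simp only [g, FunLike.coe_sum, Finset.sum_apply]
    rfl
  have hg : ∀ (v : lp X 1) (A : Finset ℕ), ∑ n ∈ A, |g n v| ≤ 1 * ‖v‖ := by
    intro v A
    calc ∑ n ∈ A, |g n v| ≤ ∑ n ∈ A, ∑ i ∈ (a n).2, ‖v i‖ := by
          refine Finset.sum_le_sum fun n _ => ?_
          rw [hgapp]
          refine (Finset.abs_sum_le_sum_abs _ _).trans (Finset.sum_le_sum fun i _ => ?_)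
          exact (ψ n i).le_of_opNorm_le (hψ1 n i) (v i) |>.trans_eq (one_mul _)
      _ = ∑ i ∈ A.biUnion fun n => (a n).2, ‖v i‖ :=
          (Finset.sum_biUnion fun m _ n _ hmn => hpair hmn).symm
      _ ≤ ‖v‖ := sum_le_hasSum _ (fun _ _ => norm_nonneg _) (lp.hasSum_norm_one v)
      _ = 1 * ‖v‖ := (one_mul _).symm
  obtain ⟨n, hn⟩ := exists_abs_apply_le_of_isCompact_toWeakSpace hg hK hε fun n => (ha n).1
  have h1 : g n (a n).1 = ∑ i ∈ (a n).2, ‖(a n).1 i‖ := by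
    rw [hgapp]
    exact Finset.sum_congr rfl fun i _ => hψ n i
  rw [h1] at hn
  exact absurd ((le_abs_self _).trans hn) (not_le.2 (ha n).2)

end Sum

/-! ### Property (K) for the sum. -/

/-- The `ℓ¹`-sum of fewer than `𝔭` real Banach spaces with property (K) has property (K). -/
theorem theorem2p10 {I : Type u} (X : I → Type v)
    [∀ i, NormedAddCommGroup (X i)] [∀ i, NormedSpace ℝ (X i)] [∀ i, CompleteSpace (X i)]
    (hK : ∀ i, PropertyK (X i))
    (hI : #I < Cardinal.lift.{u} pseudoIntersectionNumber) :
    PropertyK (lp X 1) := by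
  classical
  intro x x₀ hx
  have hxv : ∀ v, Tendsto (fun n => x n v) atTop (𝓝 (x₀ v)) := fun v =>
    ((WeakDual.eval_continuous v).tendsto _).comp hx
  let T : ∀ i, StrongDual ℝ (lp X 1) →L[ℝ] StrongDual ℝ (X i) := fun i =>
    ContinuousLinearMap.precomp ℝ (lp.singleContinuousLinearMap ℝ X 1 i)
  have hT : ∀ i f w, T i f w = f (lp.single 1 i w) := fun i f w => rfl
  obtain ⟨z, hzx, hz⟩ := exists_isAlmostConvexSubseq_forall_property x hI
    (fun i y => ∀ L : Set (X i), IsCompact (toWeakSpace ℝ (X i) '' L) →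
      TendstoUniformlyOn (fun n v => T i (y n) v) (fun v => T i x₀ v) atTop L)
    (fun i y z hyz hz L hL => by
      obtain ⟨R, hR⟩ := exists_norm_le_of_isCompact_toWeakSpace hL
      exact (hyz.map (T i)).tendstoUniformlyOn hR (hz L hL))
    (fun i z hzx => by
      have hzw : ∀ w, Tendsto (fun n => T i (z n) w) atTop (𝓝 (T i x₀ w)) := fun w =>
        hzx.tendsto_apply (hxv _)
      obtain ⟨y, hy, y₀, hyy₀⟩ := hK i (fun n => T i (z n)) (T i x₀)
        (tendsto_iff_forall_eval_tendsto_topDualPairing.2 hzw)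
      rw [tendsto_toMackeyDual_iff] at hyy₀
      have hyz := IsAlmostConvexSubseq.of_convexBlock hy
      -- Property (K) does not name the limit; testing on singletons, which are weakly compact,
      -- identifies it.
      have hy₀ : y₀ = T i x₀ := by
        ext w
        have h1 := hyy₀ {w} (by rw [Set.image_singleton]; exact isCompact_singleton)
        rw [tendstoUniformlyOn_singleton_iff_tendsto] at h1
        exact tendsto_nhds_unique h1 (hyz.tendsto_apply (hzw w))
      subst hy₀
      obtain ⟨A, a, hlt, ha, hsum, hya⟩ := hy
      -- The weights found in the dual of `X i` are reused in the dual of the sum, since `T i` is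
      -- linear.
      refine ⟨fun k => ∑ n ∈ A k, a n • z n,
        .of_convexBlock ⟨A, a, hlt, ha, hsum, fun k => rfl⟩, fun L hL => ?_⟩
      have : y = fun k => T i (∑ n ∈ A k, a n • z n) := by
        funext k
        simp only [hya, map_sum, map_smul]
      rw [this] at hyy₀
      exact hyy₀ L hL)
  obtain ⟨y, hyx, hyz⟩ := hzx.exists_convexBlock
  refine ⟨y, hyx, x₀, (tendsto_toMackeyDual_iff y x₀).2 fun L hL => ?_⟩
  have hyxv : ∀ v, Tendsto (fun n => y n v) atTop (𝓝 (x₀ v)) := fun v =>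
    (IsAlmostConvexSubseq.of_convexBlock hyx).tendsto_apply (hxv v)
  obtain ⟨C, hC⟩ := banach_steinhaus (g := fun n => y n - x₀) fun v => by
    obtain ⟨c, hc⟩ := ((hyxv v).sub_const (x₀ v)).norm.bddAbove_range
    exact ⟨c, fun n => hc ⟨n, rfl⟩⟩
  have hC0 : 0 ≤ C := (norm_nonneg _).trans (hC 0)
  rw [Metric.tendstoUniformlyOn_iff]
  intro ε hε
  -- Half of `ε` goes to the tail outside `J`, through the bound `C`, and half to the finitely many
  -- coordinates in `J`.
  obtain ⟨J, hJ⟩ := exists_finset_norm_sub_sum_single_le hL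
    (by positivity : 0 < ε / 2 / (C + 1))
  have hcoord : ∀ i ∈ J, ∀ᶠ n in atTop, ∀ v ∈ L,
      |T i (y n) (v i) - T i x₀ (v i)| < ε / 2 / (J.card + 1) := by
    intro i _
    have hLi := isCompact_toWeakSpace_image hL (lp.evalCLM ℝ X 1 i)
    obtain ⟨R, hR⟩ := exists_norm_le_of_isCompact_toWeakSpace hLi
    have := Metric.tendstoUniformlyOn_iff.1 ((hyz.map (T i)).tendstoUniformlyOn hR (hz i _ hLi))
      (ε / 2 / (J.card + 1)) (by positivity)
    filter_upwards [this] with n hn v hv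
    have := hn (v i) ⟨v, hv, rfl⟩
    rwa [dist_comm, Real.dist_eq] at this
  filter_upwards [(Finset.eventually_all J).2 hcoord] with n hn v hv
  rw [dist_comm, Real.dist_eq]
  have hsplit : y n v - x₀ v = (y n - x₀) (v - ∑ i ∈ J, lp.single 1 i (v i)) +
      ∑ i ∈ J, (T i (y n) (v i) - T i x₀ (v i)) := by
    have : ∑ i ∈ J, (T i (y n) (v i) - T i x₀ (v i)) =
        (y n - x₀) (∑ i ∈ J, lp.single 1 i (v i)) := by
      rw [map_sum]
      rfl
    rw [this, ← map_add, sub_add_cancel]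
    rfl
  have h1 : |(y n - x₀) (v - ∑ i ∈ J, lp.single 1 i (v i))| < ε / 2 := by
    calc _ ≤ C * (ε / 2 / (C + 1)) :=
          ((y n - x₀).le_opNorm _).trans
            (mul_le_mul (hC n) (hJ v hv) (norm_nonneg _) hC0)
      _ < (C + 1) * (ε / 2 / (C + 1)) := by gcongr; linarith
      _ = ε / 2 := by field_simp
  have h2 : |∑ i ∈ J, (T i (y n) (v i) - T i x₀ (v i))| ≤ ε / 2 := by
    calc _ ≤ ∑ i ∈ J, ε / 2 / (J.card + 1) :=
          (Finset.abs_sum_le_sum_abs _ _).trans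
            (Finset.sum_le_sum fun i hi => (hn i hi v hv).le)
      _ = J.card * (ε / 2 / (J.card + 1)) := by rw [Finset.sum_const, nsmul_eq_mul]
      _ ≤ (J.card + 1) * (ε / 2 / (J.card + 1)) := by gcongr; linarith
      _ = ε / 2 := by field_simp
  rw [hsplit]
  linarith [abs_add_le ((y n - x₀) (v - ∑ i ∈ J, lp.single 1 i (v i)))
    (∑ i ∈ J, (T i (y n) (v i) - T i x₀ (v i)))]
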